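/- Let $G$ be a finite simple graph on $n$ vertices that contains no copy of $K_{r+1}$, where $r\ge 3$, let $k\ge 0$ be an integer, and suppose that $$n\ \ge\ \begin{cases}6k+26 & \text{if } r=3,\\ 6k+11 & \text{if } 4\le r\le 7,\\ 2k+9 & \text{if } r\ge 8.\end{cases}$$ Write $e(H)$ for the number of edges of a graph $H$, and $T_r(m)$ for the Turán graph, that is, the complete $r$-partite graph on $m$ vertices with parts as equal in size as possible (some parts may be empty, so that $T_r(m)=K_m$ for $m\le r$). An $n$-vertex graph is called $k$-Hamiltonian (for $0\le k\le n-3$) if, for every $0\le \ell\le k$, the removal of any $\ell$ vertices leaves a graph with a Hamiltonian cycle. If $G$ is not $k$-Hamiltonian, then $$e(G)\ \le\ e(T_r(n-1))+k+1 .$$ Moreover, for such $G$, equality holds if and only if either $G$ consists of $T_r(n-1)$ plus one vertex of degree $k+1$ (that is, $G$ has a vertex $v$ of degree $k+1$ such that $G-v\cong T_r(n-1)$), or $(k,r,n)=(0,4,11)$ and $G$ is isomorphic to the complete multipartite graph $K_{6,2,2,1}$. -/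

import Mathlib

namespace SimpleGraph

/-- A graph on `n` vertices is `k`-Hamiltonian (a notion used for `k ≤ n - 3`) if deleting any set
of at most `k` vertices leaves a Hamiltonian graph. -/
def IsKHamiltonian {V : Type*} [Fintype V] [DecidableEq V] (G : SimpleGraph V) (k : ℕ) : Prop :=
  ∀ S : Finset V, S.card ≤ k → (G.induce {v : V | v ∉ S}).IsHamiltonian

/-- `G` is a `K_{r+1}`-free graph on `n` vertices consisting of the Turán graph `T_r(n-1)` plus one
vertex `v` of degree `l + 1`: deleting `v` leaves a copy of `T_r(n-1)`. -/
def IsTuranPlusVertex {V : Type*} [Fintype V] (G : SimpleGraph V) [DecidableRel G.Adj]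
    (n r l : ℕ) : Prop :=
  Fintype.card V = n ∧ G.CliqueFree (r + 1) ∧
    ∃ v : V, G.degree v = l + 1 ∧ Nonempty (G.induce {w : V | w ≠ v} ≃g turanGraph (n - 1) r)

/-- The complete multipartite graph `K_{6,2,2,1}`. -/
def K6221 : SimpleGraph (Σ i : Fin 4, Fin (![6, 2, 2, 1] i)) :=
  completeMultipartiteGraph fun i : Fin 4 => Fin (![6, 2, 2, 1] i)

end SimpleGraph

namespace SimpleGraph

open Finset Function

/-! ### Chvátal's degree condition for Hamiltonian cycles. -/

section Chvatal

variable {V : Type*} [Fintype V] [DecidableEq V]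

/-! Pick `S` with `#S ≤ k` and `G - S` not Hamiltonian. Chvátal's theorem for `G - S`
(`exists_of_not_isHamiltonian`) yields `i ≥ 1` with `2 * i + #S < n` and a set `A` of `i` vertices
of degree at most `i + #S` in `G`. Deleting `A` and applying Turán's theorem gives e(G) ≤
e(T_r(n-i)) + i(i + #S).

For `i = 1` this is the claimed bound, and equality forces `G - v` to be a Turán graph. For `i ≥ 2`
and `r ≥ 4` arithmetic (`turan_add_le`) shows it is no larger, with a tie only at `k = 0`, `r = 4`,
`n = 11`, `i = 5`; there the second clause of Chvátal's theorem pins down K_{6,2,2,1}.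

For `r = 3` the deletion bound is too weak when `i` is near `n / 2`. A weighted Turán inequality
that lowers the weight of `A` without removing it replaces it
(`CliqueFree.twelve_mul_card_edgeFinset_le`). -/

theorem isHamiltonian_iff_exists_cyclic {G : SimpleGraph V} {N : ℕ} (hV : Fintype.card V = N + 3) :
    G.IsHamiltonian ↔
      ∃ c : Fin (N + 3) → V, Injective c ∧ ∀ j, G.Adj (c j) (c (j + 1)) := by
  have key : G.IsHamiltonian ↔ cycleGraph (N + 3) ⊑ G := by
    rw [cycleGraph_isContained_iff (by omega), IsHamiltonian, ← hV]
    simp only [Walk.isHamiltonianCycle_iff_isCycle_and_length_eq]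
    exact ⟨fun h => h (by omega), fun h _ => h⟩
  rw [key]
  constructor
  · rintro ⟨f⟩
    refine ⟨f, f.injective, fun j => f.toHom.map_adj ?_⟩
    exact (cycleGraph_adj (n := N + 1)).2 (Or.inr (by abel))
  · rintro ⟨c, hc, hadj⟩
    refine ⟨⟨⟨c, fun {a b} hab => ?_⟩, hc⟩⟩
    rcases (cycleGraph_adj (n := N + 1)).1 hab with h | h
    · rw [sub_eq_iff_eq_add'.1 h]
      exact (hadj b).symm
    · rw [sub_eq_iff_eq_add'.1 h]
      exact hadj a

/-- Reroute the path: follow it from `c 0` to `c j`, jump to the last vertex `c (-1)`, walk back to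
`c (j + 1)`, and close up at `c 0`. -/
theorem isHamiltonian_of_crossing {G : SimpleGraph V} {N : ℕ} (hV : Fintype.card V = N + 3)
    {c : Fin (N + 3) → V} (hc : Injective c) (hadj : ∀ t, t ≠ -1 → G.Adj (c t) (c (t + 1)))
    {j : Fin (N + 3)} (hj : j ≠ -1) (h0 : G.Adj (c 0) (c (j + 1))) (h1 : G.Adj (c (-1)) (c j)) :
    G.IsHamiltonian := by
  have hneg : ((-1 : Fin (N + 3)) : ℕ) = N + 2 := by
    simp
  have hval : ∀ t : Fin (N + 3), t ≠ -1 → ((t + 1 : Fin (N + 3)) : ℕ) = t + 1 := by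
    intro t ht
    have : (t : ℕ) ≠ N + 2 := fun h => ht (Fin.ext (by rw [h, hneg]))
    rw [Fin.val_add, Fin.val_one]
    exact Nat.mod_eq_of_lt (by omega)
  have hsub : ∀ t : Fin (N + 3), (j : ℕ) < t → ((j - t : Fin (N + 3)) : ℕ) = N + 3 - t + j := by
    intro t ht
    rw [Fin.val_sub]
    exact Nat.mod_eq_of_lt (by omega)
  rw [isHamiltonian_iff_exists_cyclic hV]
  refine ⟨fun t => c (if (t : ℕ) ≤ j then t else j - t), fun s t hst => ?_, fun t => ?_⟩
  · have := hc hst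
    have hs := s.2
    have ht := t.2
    split_ifs at this with h1 h2 h2
    · exact this
    · have h3 := hsub t (by omega)
      rw [← this] at h3
      omega
    · have h3 := hsub s (by omega)
      rw [this] at h3
      omega
    · exact sub_right_injective this
  · have htlt := t.2
    by_cases ht : t = -1
    · subst ht
      have hj' : (j : ℕ) ≠ N + 2 := fun h => hj (Fin.ext (by rw [h, hneg]))
      have h2 : ¬ ((-1 : Fin (N + 3)) : ℕ) ≤ j := by rw [hneg]; omega
      have h3 : j - -1 = j + 1 := by abel
      have h4 : (-1 + 1 : Fin (N + 3)) = 0 := by abel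
      simp only [h2, if_false, h3, h4]
      simpa using h0.symm
    · have hv := hval t ht
      dsimp only
      rcases lt_trichotomy (t : ℕ) j with h | h | h
      · rw [if_pos h.le, if_pos (by omega)]
        exact hadj t ht
      · obtain rfl : t = j := Fin.ext h
        rw [if_pos le_rfl, if_neg (by omega)]
        have : t - (t + 1) = -1 := by abel
        rw [this]
        exact h1.symm
      · rw [if_neg (by omega), if_neg (by omega)]
        have h5 : j - t = (j - (t + 1)) + 1 := by abel
        rw [h5]
        refine (hadj _ fun h6 => ?_).symm
        have h7 : j = t := by
          have := congrArg (· + (t + 1)) h6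
          simpa using this
        omega

theorem exists_hamiltonian_path_of_sup_edge {H : SimpleGraph V} {N : ℕ}
    (hV : Fintype.card V = N + 3) (hH : ¬ H.IsHamiltonian) {u v : V}
    (huv : (H ⊔ edge u v).IsHamiltonian) :
    ∃ c : Fin (N + 3) → V, Injective c ∧ (∀ t, t ≠ -1 → H.Adj (c t) (c (t + 1))) ∧
      c 0 = u ∧ c (-1) = v := by
  obtain ⟨c, hc, hadj⟩ := (isHamiltonian_iff_exists_cyclic hV).1 huv
  obtain ⟨j, hj⟩ : ∃ j, ¬ H.Adj (c j) (c (j + 1)) := by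
    by_contra! h
    exact hH ((isHamiltonian_iff_exists_cyclic hV).2 ⟨c, hc, h⟩)
  -- A cycle of length at least 3 cannot traverse `uv` in both directions, so only one step of it
  -- lies outside `H`.
  have h2 : (1 : Fin (N + 3)) ≠ -1 := by
    intro h
    have := congrArg Fin.val h
    simp at this
  have edge_cases : ∀ t, ¬ H.Adj (c t) (c (t + 1)) →
      (c t = u ∧ c (t + 1) = v) ∨ (c t = v ∧ c (t + 1) = u) := by
    intro t ht
    have := hadj t
    rw [sup_adj, edge_adj] at this
    tauto
  rcases edge_cases j hj with ⟨ha, hb⟩ | ⟨ha, hb⟩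
  · refine ⟨fun t => c (j - t), fun s t h => sub_right_injective (hc h), fun t ht => ?_, by simpa,
      by simpa⟩
    have h5 : j - t = (j - (t + 1)) + 1 := by abel
    dsimp only
    rw [h5]
    by_contra hn
    rw [adj_comm] at hn
    rcases edge_cases _ hn with ⟨hc1, -⟩ | ⟨hc1, hc2⟩
    · have := hc (hc1.trans ha.symm)
      apply ht
      have h6 : t + 1 = 0 := by simpa using this
      exact eq_neg_of_add_eq_zero_left h6
    · have e1 := hc (hc1.trans hb.symm)
      have e2 := hc (hc2.trans ha.symm)
      apply h2
      rw [e1, add_assoc] at e2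
      have h6 : (1 + 1 : Fin (N + 3)) = 0 := by simpa using e2
      exact eq_neg_of_add_eq_zero_left h6
  · refine ⟨fun t => c (j + 1 + t), fun s t h => add_right_injective _ (hc h), fun t ht => ?_,
      by simpa, by simpa⟩
    dsimp only
    rw [← add_assoc]
    by_contra hn
    rcases edge_cases _ hn with ⟨hc1, hc2⟩ | ⟨hc1, hc2⟩
    · have e1 := hc (hc1.trans hb.symm)
      have e2 := hc (hc2.trans ha.symm)
      apply h2
      rw [e1, add_assoc] at e2
      have h6 : (1 + 1 : Fin (N + 3)) = 0 := by simpa using e2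
      exact eq_neg_of_add_eq_zero_left h6
    · have e1 := hc (hc1.trans ha.symm)
      apply ht
      have h6 : 1 + t = 0 := by simpa [add_assoc] using e1
      exact eq_neg_of_add_eq_zero_right h6

/-- `T` consists of the predecessors, on a Hamiltonian path from `u` to `v`, of the neighbours of
`u`; an edge from `v` to one of them would be a crossing. -/
theorem not_isHamiltonian_sup_edge_crossing {H : SimpleGraph V} [DecidableRel H.Adj]
    (h3 : 3 ≤ Fintype.card V) (hH : ¬ H.IsHamiltonian) {u v : V} (hnadj : ¬ H.Adj u v)
    (huv : (H ⊔ edge u v).IsHamiltonian) :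
    ∃ T : Finset V, T.card = H.degree u ∧ ∀ w ∈ T, w ≠ v ∧ ¬ H.Adj v w := by
  obtain ⟨N, hV⟩ : ∃ N, Fintype.card V = N + 3 := ⟨_, (Nat.sub_add_cancel h3).symm⟩
  obtain ⟨c, hc, hadj, rfl, rfl⟩ := exists_hamiltonian_path_of_sup_edge hV hH huv
  have hbij : Bijective c :=
    (Fintype.bijective_iff_injective_and_card c).2 ⟨hc, by simp [hV]⟩
  let e := Equiv.ofBijective c hbij
  have he : ∀ x, c (e.symm x) = x := e.apply_symm_apply
  refine ⟨(H.neighborFinset (c 0)).image fun x => c (e.symm x - 1), ?_, ?_⟩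
  · rw [card_image_of_injective, card_neighborFinset_eq_degree]
    intro x y hxy
    exact e.symm.injective (sub_left_injective (hc hxy))
  · intro w hw
    obtain ⟨x, hx, rfl⟩ := mem_image.1 hw
    rw [mem_neighborFinset] at hx
    have hne : e.symm x - 1 ≠ -1 := by
      intro h
      have h0 : e.symm x = 0 := by simpa using h
      have := he x
      rw [h0] at this
      exact hx.ne this
    refine ⟨fun h => hne (hc h), fun h => hH ?_⟩
    refine isHamiltonian_of_crossing hV hc hadj hne ?_ h
    rwa [sub_add_cancel, he]

theorem isHamiltonian_top (h3 : 3 ≤ Fintype.card V) : (⊤ : SimpleGraph V).IsHamiltonian := by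
  obtain ⟨N, hV⟩ : ∃ N, Fintype.card V = N + 3 := ⟨_, (Nat.sub_add_cancel h3).symm⟩
  rw [isHamiltonian_iff_exists_cyclic hV]
  let e := (Fintype.equivFinOfCardEq hV).symm
  refine ⟨e, e.injective, fun j => ?_⟩
  rw [top_adj]
  intro h
  simpa using e.injective h

/-- **Chvátal's theorem** on Hamiltonian degree sequences. -/
theorem exists_of_not_isHamiltonian (G : SimpleGraph V) [DecidableRel G.Adj]
    (h3 : 3 ≤ Fintype.card V) (hG : ¬ G.IsHamiltonian) :
    ∃ i, 1 ≤ i ∧ 2 * i < Fintype.card V ∧ i ≤ #{v | G.degree v ≤ i} ∧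
      Fintype.card V - i ≤ #{v | G.degree v < Fintype.card V - i} := by
  classical
  -- Adding edges only raises degrees, so the conclusion for an edge-maximal non-Hamiltonian
  -- supergraph descends to `G`.
  obtain ⟨H, hGH, hmax⟩ := Finite.exists_le_maximal (p := fun H : SimpleGraph V => ¬ H.IsHamiltonian)
    hG
  have hH : ¬ H.IsHamiltonian := hmax.prop
  suffices h : ∃ i, 1 ≤ i ∧ 2 * i < Fintype.card V ∧ i ≤ #{v | H.degree v ≤ i} ∧
      Fintype.card V - i ≤ #{v | H.degree v < Fintype.card V - i} by
    obtain ⟨i, h1, h2, h3, h4⟩ := h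
    refine ⟨i, h1, h2, h3.trans (card_le_card ?_), h4.trans (card_le_card ?_)⟩
    · intro v hv
      simp only [mem_filter, mem_univ, true_and] at hv ⊢
      exact (degree_le_of_le hGH).trans hv
    · intro v hv
      simp only [mem_filter, mem_univ, true_and] at hv ⊢
      exact (degree_le_of_le hGH).trans_lt hv
  have hsup : ∀ u v, u ≠ v → ¬ H.Adj u v → (H ⊔ edge u v).IsHamiltonian := by
    intro u v huv hadj
    by_contra hn
    have := hmax.le_of_ge hn le_sup_left
    exact hadj (this (Or.inr (by simp [edge_adj, huv])))
  have hne : ({p : V × V | p.1 ≠ p.2 ∧ ¬ H.Adj p.1 p.2} : Finset (V × V)).Nonempty := by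
    by_contra hn
    rw [not_nonempty_iff_eq_empty, filter_eq_empty_iff] at hn
    apply hH
    have : H = ⊤ := by
      ext a b
      have := @hn (a, b) (mem_univ _)
      simp only [top_adj]
      refine ⟨fun h => h.ne, fun h => ?_⟩
      tauto
    rw [this]
    exact isHamiltonian_top h3
  -- With the degree sum maximal and `u` the end of smaller degree, the witness is `i = H.degree u`:
  -- the vertices of `T` have degree at most that of `u`, and the non-neighbours of `u` at most that
  -- of `v`.
  obtain ⟨⟨u, v⟩, huv, hmaxuv⟩ :=
    exists_max_image _ (fun p : V × V => H.degree p.1 + H.degree p.2) hne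
  simp only [mem_filter, mem_univ, true_and] at huv hmaxuv
  obtain ⟨hne', hnadj⟩ := huv
  replace hmaxuv : ∀ a b, a ≠ b → ¬ H.Adj a b → H.degree a + H.degree b ≤
    H.degree u + H.degree v := fun a b h1 h2 => hmaxuv (a, b) ⟨h1, h2⟩
  clear hne
  wlog hle : H.degree u ≤ H.degree v generalizing u v
  · exact this v u hne'.symm (fun h => hnadj h.symm)
      (fun a b h1 h2 => (hmaxuv a b h1 h2).trans (add_comm _ _).le) (by omega)
  obtain ⟨T, hTcard, hT⟩ :=
    not_isHamiltonian_sup_edge_crossing h3 hH hnadj (hsup u v hne' hnadj)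
  have hsum : H.degree u + H.degree v < Fintype.card V := by
    have hd : Disjoint T (H.neighborFinset v) := by
      rw [Finset.disjoint_left]
      intro w hw hw'
      exact (hT w hw).2 ((H.mem_neighborFinset _ _).1 hw')
    have hv : v ∉ T ∪ H.neighborFinset v := by
      rw [mem_union, mem_neighborFinset]
      rintro (h | h)
      · exact (hT v h).1 rfl
      · exact H.irrefl h
    have := card_lt_univ_of_notMem hv
    rwa [card_union_of_disjoint hd, hTcard, card_neighborFinset_eq_degree] at this
  have hnon : Fintype.card V - H.degree u ≤ #{w | ¬ H.Adj u w} := by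
    have : ({w | ¬ H.Adj u w} : Finset V) = (H.neighborFinset u)ᶜ := by
      ext; simp
    rw [this, card_compl, card_neighborFinset_eq_degree]
  -- `i` must be positive. If `u` is isolated, `i = 1` works, since every other vertex misses both
  -- itself and `u`.
  rcases Nat.eq_zero_or_pos (H.degree u) with h0 | hpos
  · refine ⟨1, le_rfl, by omega, ?_, ?_⟩
    · refine card_pos.2 ⟨u, ?_⟩
      simp [h0]
    · refine le_trans ?_ (card_le_card (s := univ.erase u) ?_)
      · rw [card_erase_of_mem (mem_univ _), card_univ]
      · intro w hw
        have hwu := (mem_erase.1 hw).1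
        simp only [mem_filter, mem_univ, true_and]
        have := hmaxuv u w hwu.symm fun h => by
          have : 0 < H.degree u := (H.degree_pos_iff_exists_adj u).2 ⟨w, h⟩
          omega
        have h5 : w ∉ H.neighborFinset w ∪ {u} := by simp [hwu]
        have h6 := card_lt_univ_of_notMem h5
        rw [card_union_of_disjoint, card_neighborFinset_eq_degree, card_singleton] at h6
        · omega
        · rw [Finset.disjoint_singleton_right, mem_neighborFinset]
          intro h
          have : 0 < H.degree u := (H.degree_pos_iff_exists_adj u).2 ⟨w, h.symm⟩
          omega
  · refine ⟨H.degree u, hpos, by omega, ?_, ?_⟩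
    · rw [← hTcard]
      refine card_le_card fun w hw => ?_
      simp only [mem_filter, mem_univ, true_and]
      have := hmaxuv v w (hT w hw).1.symm (hT w hw).2
      omega
    · refine hnon.trans (card_le_card fun w hw => ?_)
      simp only [mem_filter, mem_univ, true_and] at hw ⊢
      by_cases hwu : w = u
      · subst hwu; omega
      · have := hmaxuv u w (Ne.symm hwu) hw
        omega

end Chvatal

/-! ### Counting edges after deleting vertices. -/

section EdgeCount

variable {V : Type*} [Fintype V]

theorem two_mul_card_edgeFinset_induce (G : SimpleGraph V) [DecidableRel G.Adj] (B : Finset V)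
    {s : Set V} (hs : ∀ v, v ∈ s ↔ v ∈ B) [Fintype (G.induce s).edgeSet] :
    2 * #(G.induce s).edgeFinset = ∑ u ∈ B, ∑ v ∈ B, if G.Adj u v then 1 else 0 := by
  classical
  have h1 : 2 * #(G.induce s).edgeFinset = ∑ x, (G.induce s).degree x := by
    rw [sum_degrees_eq_twice_card_edges]
    congr!
  have h2 : ∀ f : V → ℕ, ∑ x : s, f x = ∑ u ∈ B, f u := fun f =>
    (Finset.sum_subtype B (fun x => (hs x).symm) f).symm
  rw [h1, ← h2]
  refine Finset.sum_congr rfl fun x _ => ?_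
  rw [← h2, ← card_neighborFinset_eq_degree, neighborFinset_eq_filter, card_filter]
  rfl

theorem degree_eq_sum_ite (G : SimpleGraph V) [DecidableRel G.Adj] (u : V) :
    G.degree u = ∑ v, if G.Adj u v then 1 else 0 := by
  rw [← card_neighborFinset_eq_degree, neighborFinset_eq_filter, card_filter]

variable [DecidableEq V]

/-- The degree sum over `A` counts edges inside `A` twice. Keeping this correction exact lets
equality later force `A` to be independent. -/
theorem two_mul_card_edgeFinset_add (G : SimpleGraph V) [DecidableRel G.Adj] (A : Finset V)
    {s : Set V} (hs : ∀ v, v ∈ s ↔ v ∉ A) [Fintype (G.induce s).edgeSet] :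
    2 * #G.edgeFinset + ∑ v ∈ A, #{w ∈ A | G.Adj v w} =
      2 * #(G.induce s).edgeFinset + 2 * ∑ v ∈ A, G.degree v := by
  rw [two_mul_card_edgeFinset_induce G Aᶜ (by simpa using hs), ← sum_degrees_eq_twice_card_edges]
  simp only [degree_eq_sum_ite, card_filter]
  set f : V → V → ℕ := fun u v => if G.Adj u v then 1 else 0 with hf
  have hsymm : ∑ u ∈ Aᶜ, ∑ v ∈ A, f u v = ∑ u ∈ A, ∑ v ∈ Aᶜ, f u v := by
    rw [Finset.sum_comm]
    simp only [hf, G.adj_comm]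
  have e1 : ∀ g : V → ℕ, ∑ u, g u = ∑ u ∈ A, g u + ∑ u ∈ Aᶜ, g u := fun g =>
    (Finset.sum_add_sum_compl A g).symm
  have e2 : ∀ B : Finset V, ∑ u ∈ B, ∑ v, f u v = ∑ u ∈ B, ∑ v ∈ A, f u v + ∑ u ∈ B, ∑ v ∈ Aᶜ, f u v := by
    intro B
    rw [← Finset.sum_add_distrib]
    exact Finset.sum_congr rfl fun u _ => e1 _
  rw [e1 fun u => ∑ v, f u v, e2, e2, hsymm]
  ring

theorem card_edgeFinset_eq_induce_add_degree (G : SimpleGraph V) [DecidableRel G.Adj] (v : V)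
    {s : Set V} (hs : ∀ w, w ∈ s ↔ w ≠ v) [Fintype (G.induce s).edgeSet] :
    #G.edgeFinset = #(G.induce s).edgeFinset + G.degree v := by
  have := two_mul_card_edgeFinset_add G {v} (s := s) (by simpa using hs)
  rw [sum_singleton, sum_singleton, filter_singleton, if_neg (G.irrefl), card_empty] at this
  omega

theorem degree_le_degree_induce_add_card (G : SimpleGraph V) [DecidableRel G.Adj] (S : Finset V)
    {s : Set V} (hs : ∀ w, w ∈ s ↔ w ∉ S) (v : s) [Fintype ((G.induce s).neighborSet v)] :
    G.degree v ≤ (G.induce s).degree v + #S := by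
  classical
  have : G.neighborFinset v ⊆
      ((G.induce s).neighborFinset v).map (Embedding.subtype _) ∪ S := by
    intro w hw
    rw [mem_neighborFinset] at hw
    by_cases hS : w ∈ S
    · exact mem_union_right _ hS
    · refine mem_union_left _ (mem_map.2 ⟨⟨w, (hs w).2 hS⟩, ?_, rfl⟩)
      rw [mem_neighborFinset]
      exact hw
  rw [← card_neighborFinset_eq_degree, ← card_neighborFinset_eq_degree]
  exact (card_le_card this).trans ((card_union_le _ _).trans (by rw [card_map]))

end EdgeCount

/-! ### Turán numbers and their numerical comparison. -/

section Turan

variable {V : Type*} [Fintype V]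

theorem CliqueFree.card_edgeFinset_le_turanGraph {G : SimpleGraph V} [Fintype G.edgeSet] {r : ℕ}
    (h : G.CliqueFree (r + 1)) :
    #G.edgeFinset ≤ #(turanGraph (Fintype.card V) r).edgeFinset := by
  classical
  rw [card_edgeFinset_turanGraph]
  convert h.card_edgeFinset_le

theorem CliqueFree.nonempty_iso_turanGraph {G : SimpleGraph V} [Fintype G.edgeSet] {r : ℕ}
    (h : G.CliqueFree (r + 1))
    (hG : #(turanGraph (Fintype.card V) r).edgeFinset ≤ #G.edgeFinset) :
    Nonempty (G ≃g turanGraph (Fintype.card V) r) := by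
  classical
  have : G.IsTuranMaximal r := by
    refine ⟨h, fun H _ hH => ?_⟩
    refine hH.card_edgeFinset_le_turanGraph.trans (hG.trans (le_of_eq ?_))
    congr!
  exact this.nonempty_iso_turanGraph

theorem card_edgeFinset_turanGraph_of_le {n r : ℕ} (h : n ≤ r) :
    #(turanGraph n r).edgeFinset = n.choose 2 := by
  have : turanGraph n r = ⊤ := turanGraph_eq_top.2 (Or.inr h)
  have h2 := card_edgeFinset_top_eq_card_choose_two (V := Fin n)
  rw [Fintype.card_fin] at h2
  rw [← h2]
  congr!

/-- The new vertex joins a smallest part, of size `m / r`, and is adjacent to everything else. -/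
theorem card_edgeFinset_turanGraph_succ {r : ℕ} (hr : 0 < r) (m : ℕ) :
    #(turanGraph (m + 1) r).edgeFinset = #(turanGraph m r).edgeFinset + (m - m / r) := by
  induction m using Nat.strong_induction_on with
  | _ m ih =>
    rcases lt_or_ge m r with h | h
    · rw [card_edgeFinset_turanGraph_of_le h, card_edgeFinset_turanGraph_of_le h.le,
        Nat.div_eq_of_lt h, Nat.choose_succ_succ' m 1, Nat.choose_one_right, Nat.sub_zero, add_comm]
    · obtain ⟨d, rfl⟩ := Nat.exists_eq_add_of_le' h
      have := ih d (by omega)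
      rw [show d + r + 1 = d + 1 + r by ring, card_edgeFinset_turanGraph_add,
        card_edgeFinset_turanGraph_add, this, Nat.add_div_right _ hr]
      have h1 : d / r ≤ d := Nat.div_le_self _ _
      obtain ⟨q, rfl⟩ : ∃ q, r = q + 1 := ⟨r - 1, by omega⟩
      have h2 : d + (q + 1) - (d / (q + 1)).succ = d - d / (q + 1) + q := by omega
      rw [h2, Nat.add_sub_cancel, add_mul]
      ring

/-- The increments `m - m / r` grow with `r`, so the comparison for `r ≥ 4` reduces to `r = 4` and
`r = 8`. -/
theorem card_edgeFinset_turanGraph_add_add_le {r s : ℕ} (hs : 0 < s) (hsr : s ≤ r) (m d : ℕ) :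
    #(turanGraph (m + d) s).edgeFinset + #(turanGraph m r).edgeFinset ≤
      #(turanGraph (m + d) r).edgeFinset + #(turanGraph m s).edgeFinset := by
  induction d with
  | zero => simp [add_comm]
  | succ d ih =>
    rw [← add_assoc, card_edgeFinset_turanGraph_succ hs,
      card_edgeFinset_turanGraph_succ (hs.trans_le hsr)]
    have : (m + d) / r ≤ (m + d) / s := Nat.div_le_div_left hsr hs
    omega

theorem sq_le_three_mul_card_edgeFinset_turanGraph (n : ℕ) :
    n ^ 2 ≤ 3 * #(turanGraph n 3).edgeFinset + 1 := by
  induction n using Nat.strong_induction_on with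
  | _ n ih =>
    rcases lt_or_ge n 3 with h | h
    · rw [card_edgeFinset_turanGraph_of_le h.le]
      interval_cases n <;> simp
    · obtain ⟨d, rfl⟩ := Nat.exists_eq_add_of_le' h
      have := ih d (by omega)
      rw [card_edgeFinset_turanGraph_add]
      simp only [Nat.choose]
      nlinarith

theorem three_mul_sq_le_card_edgeFinset_turanGraph (n : ℕ) :
    3 * n ^ 2 ≤ 8 * #(turanGraph n 4).edgeFinset + 4 := by
  induction n using Nat.strong_induction_on with
  | _ n ih =>
    rcases lt_or_ge n 4 with h | h
    · rw [card_edgeFinset_turanGraph_of_le h.le]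
      interval_cases n <;> simp [Nat.choose]
    · obtain ⟨d, rfl⟩ := Nat.exists_eq_add_of_le' h
      have := ih d (by omega)
      rw [card_edgeFinset_turanGraph_add]
      simp only [Nat.choose]
      nlinarith

theorem seven_mul_sq_le_card_edgeFinset_turanGraph (n : ℕ) :
    7 * n ^ 2 ≤ 16 * #(turanGraph n 8).edgeFinset + 16 := by
  induction n using Nat.strong_induction_on with
  | _ n ih =>
    rcases lt_or_ge n 8 with h | h
    · rw [card_edgeFinset_turanGraph_of_le h.le]
      interval_cases n <;> simp [Nat.choose]
    · obtain ⟨d, rfl⟩ := Nat.exists_eq_add_of_le' h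
      have := ih d (by omega)
      rw [card_edgeFinset_turanGraph_add]
      simp only [Nat.choose]
      nlinarith

theorem turan_four_add_le {n i k : ℕ} (hi : 2 ≤ i) (hin : 2 * i + k < n) (hn : 6 * k + 11 ≤ n) :
    #(turanGraph (n - i) 4).edgeFinset + i * (i + k) ≤
        #(turanGraph (n - 1) 4).edgeFinset + (k + 1) ∧
      (#(turanGraph (n - i) 4).edgeFinset + i * (i + k) =
        #(turanGraph (n - 1) 4).edgeFinset + (k + 1) → k = 0 ∧ n = 11 ∧ i = 5) := by
  have h1 := three_mul_sq_le_card_edgeFinset_turanGraph (n - 1)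
  have h2 := mul_card_edgeFinset_turanGraph_le (n := n - i) (r := 4)
  generalize #(turanGraph (n - i) 4).edgeFinset = x at *
  generalize #(turanGraph (n - 1) 4).edgeFinset = y at *
  zify [show 1 ≤ n by omega, show i ≤ n by omega] at *
  push_cast at *
  -- The 4 is the rounding error in the lower bound for e(T_4(n-1)). It is less than 8, so a
  -- nonnegative product already gives the inequality by integrality.
  have h3 : ((i : ℤ) - 1) * (6 * n - 11 * i - 11 - 8 * k) - 4 ≤
      8 * (y + (k + 1) - (x + i * (i + k))) := by nlinarith
  have hX : (0 : ℤ) ≤ 6 * n - 11 * i - 11 - 8 * k := by omega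
  constructor
  · have : 0 ≤ ((i : ℤ) - 1) * (6 * n - 11 * i - 11 - 8 * k) := mul_nonneg (by omega) hX
    omega
  · intro heq
    have h4 : ((i : ℤ) - 1) * (6 * n - 11 * i - 11 - 8 * k) ≤ 4 := by omega
    rcases lt_or_ge i 6 with h | h
    · interval_cases i <;> omega
    · have h5 : (6 * n - 11 * i - 11 - 8 * k : ℤ) ≤ 0 := by
        by_contra! hc
        nlinarith
      omega

theorem turan_eight_add_lt {n i k : ℕ} (hi : 2 ≤ i) (hin : 2 * i + k < n) (hn : 2 * k + 9 ≤ n) :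
    #(turanGraph (n - i) 8).edgeFinset + i * (i + k) <
        #(turanGraph (n - 1) 8).edgeFinset + (k + 1) := by
  have h1 := seven_mul_sq_le_card_edgeFinset_turanGraph (n - 1)
  have h2 := mul_card_edgeFinset_turanGraph_le (n := n - i) (r := 8)
  generalize #(turanGraph (n - i) 8).edgeFinset = x at *
  generalize #(turanGraph (n - 1) 8).edgeFinset = y at *
  zify [show 1 ≤ n by omega, show i ≤ n by omega] at *
  push_cast at *
  have h3 : ((i : ℤ) - 1) * (14 * n - 23 * i - 23 - 16 * k) - 16 ≤
      16 * (y + (k + 1) - (x + i * (i + k))) := by nlinarith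
  have h4 : 16 < ((i : ℤ) - 1) * (14 * n - 23 * i - 23 - 16 * k) := by
    rcases lt_or_ge i 3 with h | h
    · obtain rfl : i = 2 := by omega
      push_cast
      omega
    · have : (11 : ℤ) ≤ 14 * n - 23 * i - 23 - 16 * k := by omega
      nlinarith
  omega

theorem turan_add_le {n r i k : ℕ} (hr : 4 ≤ r) (hi : 2 ≤ i) (hin : 2 * i + k < n)
    (hn : (if r ≤ 7 then 6 * k + 11 else 2 * k + 9) ≤ n) :
    #(turanGraph (n - i) r).edgeFinset + i * (i + k) ≤
        #(turanGraph (n - 1) r).edgeFinset + (k + 1) ∧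
      (#(turanGraph (n - i) r).edgeFinset + i * (i + k) =
        #(turanGraph (n - 1) r).edgeFinset + (k + 1) → k = 0 ∧ r = 4 ∧ n = 11 ∧ i = 5) := by
  have hd : n - 1 = n - i + (i - 1) := by omega
  split_ifs at hn with h7
  · obtain ⟨h1, h2⟩ := turan_four_add_le hi hin hn
    have h3 := card_edgeFinset_turanGraph_add_add_le (by norm_num) hr (n - i) (i - 1)
    rw [← hd] at h3
    refine ⟨by omega, fun heq => ?_⟩
    obtain ⟨rfl, rfl, rfl⟩ := h2 (by omega)
    refine ⟨rfl, ?_, rfl, rfl⟩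
    -- For `r ≥ 5`, passing from 6 to 10 vertices gains at least 5 + 6 + 7 + 8 = 26 edges, whereas a
    -- tie requires 24.
    by_contra hr4
    have h6 : #(turanGraph 7 r).edgeFinset = #(turanGraph 6 r).edgeFinset + (6 - 6 / r) :=
      card_edgeFinset_turanGraph_succ (by omega) 6
    have h7 : #(turanGraph 8 r).edgeFinset = #(turanGraph 7 r).edgeFinset + (7 - 7 / r) :=
      card_edgeFinset_turanGraph_succ (by omega) 7
    have h8 : #(turanGraph 9 r).edgeFinset = #(turanGraph 8 r).edgeFinset + (8 - 8 / r) :=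
      card_edgeFinset_turanGraph_succ (by omega) 8
    have h9 : #(turanGraph 10 r).edgeFinset = #(turanGraph 9 r).edgeFinset + (9 - 9 / r) :=
      card_edgeFinset_turanGraph_succ (by omega) 9
    have hdiv : ∀ m < 10, m / r ≤ 1 := fun m hm =>
      Nat.lt_succ_iff.1 ((Nat.div_lt_iff_lt_mul (by omega)).2 (by omega))
    have := hdiv 6 (by norm_num)
    have := hdiv 7 (by norm_num)
    have := hdiv 8 (by norm_num)
    have := hdiv 9 (by norm_num)
    have e1 : #(turanGraph (11 - 5) r).edgeFinset = #(turanGraph 6 r).edgeFinset := rfl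
    have e2 : #(turanGraph (11 - 1) r).edgeFinset = #(turanGraph 10 r).edgeFinset := rfl
    have e3 : #(turanGraph (11 - 5) 4).edgeFinset = 13 := by decide
    have e4 : #(turanGraph (11 - 1) 4).edgeFinset = 37 := by decide
    omega
  · have h2 := turan_eight_add_lt hi hin hn
    have h3 := card_edgeFinset_turanGraph_add_add_le (by norm_num) (show 8 ≤ r by omega) (n - i)
      (i - 1)
    rw [← hd] at h3
    exact ⟨by omega, fun heq => by omega⟩

end Turan

/-! ### Weighted Turán inequality and the case `r = 3`. -/

section WeightedTuran

variable {V : Type*} [Fintype V] {G : SimpleGraph V} [DecidableRel G.Adj]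

/-- The weighted form of Turán's bound, for natural number weights. -/
theorem CliqueFree.mul_sum_adj_mul_le {r : ℕ} (h : G.CliqueFree (r + 1)) (w : V → ℕ) :
    r * ∑ u, ∑ v, (if G.Adj u v then w u * w v else 0) ≤ (r - 1) * (∑ v, w v) ^ 2 := by
  classical
  -- Blow up each `v` into `w v` independent copies; a clique uses at most one copy of each vertex,
  -- so Turán's theorem still applies.
  let H : SimpleGraph (Σ v, Fin (w v)) := G.comap Sigma.fst
  have hH : H.CliqueFree (r + 1) := by
    have hr : r + 1 = Fintype.card (Fin (r + 1)) := (Fintype.card_fin _).symm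
    rw [hr, cliqueFree_iff_top_free] at h ⊢
    rintro ⟨f⟩
    let g : H →g G := ⟨Sigma.fst, fun hab => hab⟩
    exact h ⟨⟨g.comp f.toHom, Hom.injective_of_top_hom _⟩⟩
  have h1 := hH.card_edgeFinset_le_turanGraph
  have h2 := mul_card_edgeFinset_turanGraph_le (n := Fintype.card (Σ v, Fin (w v))) (r := r)
  have h3 : ∑ u, ∑ v, (if G.Adj u v then w u * w v else 0) = 2 * #H.edgeFinset := by
    have hdeg : ∀ p, H.degree p = ∑ v, if G.Adj p.1 v then w v else 0 := fun p => by
      rw [degree_eq_sum_ite, Fintype.sum_sigma]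
      refine Finset.sum_congr rfl fun v _ => ?_
      by_cases hv : G.Adj p.1 v
      · have hv' : ∀ j, H.Adj p ⟨v, j⟩ := fun _ => hv
        simp [hv, hv']
      · have hv' : ∀ j, ¬ H.Adj p ⟨v, j⟩ := fun _ => hv
        simp [hv, hv']
    rw [← sum_degrees_eq_twice_card_edges, Fintype.sum_sigma]
    refine Finset.sum_congr rfl fun u _ => ?_
    have hu : ∀ i, H.degree ⟨u, i⟩ = ∑ v, if G.Adj u v then w v else 0 := fun i => hdeg ⟨u, i⟩
    rw [Finset.sum_congr rfl fun i _ => hu i, Finset.sum_const, card_univ, Fintype.card_fin,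
      smul_eq_mul, Finset.mul_sum]
    simp only [mul_ite, mul_zero]
  rw [h3]
  simp only [Fintype.card_sigma, Fintype.card_fin] at h1 h2
  calc r * (2 * #H.edgeFinset) = 2 * r * #H.edgeFinset := by ring
    _ ≤ _ := (Nat.mul_le_mul_left _ h1).trans h2

/-- Edge by edge, with deficits x and y at the ends, this is q² ≤ (q-x)(q-y) + qx + qy. -/
theorem sq_mul_two_mul_card_edgeFinset_le (w : V → ℕ) {q : ℕ} (hw : ∀ v, w v ≤ q) :
    q ^ 2 * (2 * #G.edgeFinset) ≤ (∑ u, ∑ v, if G.Adj u v then w u * w v else 0) +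
      2 * q * ∑ v, (q - w v) * G.degree v := by
  have h1 : q ^ 2 * (2 * #G.edgeFinset) = ∑ u, ∑ v, if G.Adj u v then q ^ 2 else 0 := by
    rw [← sum_degrees_eq_twice_card_edges, Finset.mul_sum]
    simp only [degree_eq_sum_ite, Finset.mul_sum, mul_ite, mul_one, mul_zero]
  have h2 : ∑ v, (q - w v) * G.degree v = ∑ u, ∑ v, if G.Adj u v then (q - w u) else 0 := by
    simp only [degree_eq_sum_ite, Finset.mul_sum, mul_ite, mul_one, mul_zero]
  have h3 : ∑ v, (q - w v) * G.degree v = ∑ u, ∑ v, if G.Adj u v then (q - w v) else 0 := by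
    rw [h2, Finset.sum_comm]
    simp only [G.adj_comm]
  have h4 : 2 * q * ∑ v, (q - w v) * G.degree v =
      ∑ u, ∑ v, if G.Adj u v then q * (q - w u) + q * (q - w v) else 0 := by
    rw [two_mul, add_mul]
    nth_rewrite 1 [h2]
    rw [h3]
    simp only [Finset.mul_sum, ← Finset.sum_add_distrib]
    refine Finset.sum_congr rfl fun u _ => Finset.sum_congr rfl fun v _ => ?_
    split_ifs <;> simp
  rw [h1, h4]
  simp only [← Finset.sum_add_distrib]
  refine Finset.sum_le_sum fun u _ => Finset.sum_le_sum fun v _ => ?_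
  split_ifs
  · obtain ⟨x, hx⟩ := Nat.exists_eq_add_of_le (hw u)
    obtain ⟨y, hy⟩ := Nat.exists_eq_add_of_le (hw v)
    have e1 : q - w u = x := by omega
    have e2 : q - w v = y := by omega
    rw [e1, e2]
    zify at *
    have e3 : (w u : ℤ) = q - x := by omega
    have e4 : (w v : ℤ) = q - y := by omega
    rw [e3, e4]
    nlinarith [Int.natCast_nonneg x, Int.natCast_nonneg y,
      mul_nonneg (Int.natCast_nonneg x) (Int.natCast_nonneg y)]
  · simp

variable [DecidableEq V]

/-- Weights `2 * a - s` on `A` and `2 * a` elsewhere give 12e ≤ (2n-s)² + 6s(a+k). The prescribed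
`s` minimises the right side, and `s ≤ 2 * a` keeps the weights nonnegative. -/
theorem CliqueFree.twelve_mul_card_edgeFinset_le (h : G.CliqueFree 4) {A : Finset V} {a k s : ℕ}
    (hA : #A = a) (ha : 0 < a) (hdeg : ∀ v ∈ A, G.degree v ≤ a + k)
    (hs : s + 3 * a + 3 * k = 2 * Fintype.card V) (hsa : s ≤ 2 * a) :
    12 * #G.edgeFinset + s ^ 2 ≤ 4 * Fintype.card V ^ 2 := by
  set n := Fintype.card V
  let w : V → ℕ := fun v => if v ∈ A then 2 * a - s else 2 * a
  have hw : ∀ v, w v ≤ 2 * a := fun v => by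
    dsimp only [w]
    split_ifs <;> omega
  have h1 := sq_mul_two_mul_card_edgeFinset_le (G := G) w hw
  have h2 := CliqueFree.mul_sum_adj_mul_le (r := 3) h w
  have h3 : ∑ v, w v + a * s = n * (2 * a) := by
    have e1 : a * s = ∑ v, if v ∈ A then s else 0 := by
      rw [← Finset.sum_filter, Finset.filter_mem_eq_inter, univ_inter, Finset.sum_const, hA,
        smul_eq_mul]
    have e2 : n * (2 * a) = ∑ v : V, 2 * a := by
      rw [Finset.sum_const, card_univ, smul_eq_mul]
    rw [e1, e2, ← Finset.sum_add_distrib]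
    refine Finset.sum_congr rfl fun v _ => ?_
    dsimp only [w]
    split_ifs <;> omega
  have h4 : ∑ v, (2 * a - w v) * G.degree v ≤ s * (a * (a + k)) := by
    have e1 : ∑ v, (2 * a - w v) * G.degree v = ∑ v ∈ A, s * G.degree v := by
      rw [← Finset.sum_filter_add_sum_filter_not univ (· ∈ A), Finset.filter_mem_eq_inter,
        univ_inter]
      have : ∑ x with x ∉ A, (2 * a - w x) * G.degree x = 0 := by
        refine Finset.sum_eq_zero fun v hv => ?_
        simp [w, (mem_filter.1 hv).2]
      rw [this, add_zero]
      refine Finset.sum_congr rfl fun v hv => ?_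
      have : 2 * a - w v = s := by
        simp only [w, hv, if_true]
        omega
      rw [this]
    rw [e1, ← Finset.mul_sum]
    refine Nat.mul_le_mul_left _ ((Finset.sum_le_card_nsmul _ _ _ hdeg).trans ?_)
    rw [hA, smul_eq_mul]
  generalize ∑ v, (2 * a - w v) * G.degree v = D at *
  generalize ∑ u, ∑ v, (if G.Adj u v then w u * w v else 0) = W at *
  generalize ∑ v, w v = T at *
  generalize #G.edgeFinset = e at *
  have hsn : s ≤ 2 * n := by omega
  obtain ⟨m, hm⟩ := Nat.exists_eq_add_of_le hsn
  have hT : T = a * m := by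
    have : T + a * s = a * m + a * s := by rw [h3]; nlinarith
    omega
  subst hT
  have h5 : a ^ 2 * (12 * e) ≤ a ^ 2 * (m ^ 2 + 6 * s * (a + k)) := by
    have h6 : 2 * (2 * a) * D ≤ 2 * (2 * a) * (s * (a * (a + k))) := Nat.mul_le_mul_left _ h4
    norm_num at h2
    nlinarith
  have h7 := Nat.le_of_mul_le_mul_left h5 (by positivity)
  nlinarith

theorem CliqueFree.card_edgeFinset_le_turanGraph_add {r a d : ℕ} (h : G.CliqueFree (r + 1))
    {A : Finset V} (hA : #A = a) (hdeg : ∀ v ∈ A, G.degree v ≤ d) :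
    #G.edgeFinset ≤ #(turanGraph (Fintype.card V - a) r).edgeFinset + a * d := by
  have h1 := two_mul_card_edgeFinset_add G A (s := {v | v ∉ A}) (fun v => Iff.rfl)
  have h2 := (h.comap ⟨(Embedding.induce {v | v ∉ A}).toCopy⟩).card_edgeFinset_le_turanGraph
  have h3 : Fintype.card {v | v ∉ A} = Fintype.card V - a := by
    rw [← hA, ← card_compl]
    exact Fintype.card_of_subtype _ (by simp)
  have h4 := Finset.sum_le_card_nsmul _ _ _ hdeg
  rw [hA, smul_eq_mul] at h4
  rw [h3] at h2
  omega

theorem CliqueFree.card_edgeFinset_lt_of_three {a k : ℕ} (h : G.CliqueFree 4) {A : Finset V}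
    (hA : #A = a) (ha : 2 ≤ a) (hdeg : ∀ v ∈ A, G.degree v ≤ a + k)
    (han : 2 * a + k < Fintype.card V) (hn : 6 * k + 26 ≤ Fintype.card V) :
    #G.edgeFinset < #(turanGraph (Fintype.card V - 1) 3).edgeFinset + (k + 1) := by
  have h0 := sq_le_three_mul_card_edgeFinset_turanGraph (Fintype.card V - 1)
  -- In the first case the optimal weight on `A` would be negative, so `A` is deleted outright. In
  -- the second, it remains to check s² > 8n - 12k - 12.
  rcases lt_or_ge (5 * a + 3 * k) (2 * Fintype.card V) with hc | hc
  · have h1 := h.card_edgeFinset_le_turanGraph_add (r := 3) hA hdeg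
    have h2 := mul_card_edgeFinset_turanGraph_le (n := Fintype.card V - a) (r := 3)
    generalize #(turanGraph (Fintype.card V - a) 3).edgeFinset = x at *
    generalize #(turanGraph (Fintype.card V - 1) 3).edgeFinset = y at *
    generalize #G.edgeFinset = e at *
    generalize Fintype.card V = n at *
    clear h hdeg hA
    zify [show 1 ≤ n by omega, show a ≤ n by omega] at *
    push_cast at *
    have h3 : 2 * (n : ℤ) - 3 * k - 3 < a * (2 * n - 4 * a - 3 * k) := by
      rcases lt_or_ge a 4 with h4 | h4
      · have : a = 2 ∨ a = 3 := by omega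
        rcases this with rfl | rfl <;> push_cast <;> omega
      · nlinarith [mul_nonneg (show (0 : ℤ) ≤ a - 1 by omega)
          (show (0 : ℤ) ≤ 2 * n - 3 * k - 5 * a - 1 by omega)]
    nlinarith
  · obtain ⟨s, hs⟩ := Nat.exists_eq_add_of_le (show 3 * a + 3 * k ≤ 2 * Fintype.card V by omega)
    have h1 := h.twelve_mul_card_edgeFinset_le (s := s) hA (by omega) hdeg (by omega) (by omega)
    generalize #(turanGraph (Fintype.card V - 1) 3).edgeFinset = y at *
    generalize #G.edgeFinset = e at *
    generalize Fintype.card V = n at *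
    clear h hdeg hA
    have h2 : n + 3 ≤ 2 * s + 3 * k := by omega
    obtain ⟨t, rfl⟩ := Nat.exists_eq_add_of_le hn
    have h3 : 3 * k + 29 + t ≤ 2 * s := by omega
    have h4 := Nat.pow_le_pow_left h3 2
    zify [show 1 ≤ 6 * k + 26 + t by omega] at *
    nlinarith [mul_nonneg (Int.natCast_nonneg k) (Int.natCast_nonneg t)]

end WeightedTuran

/-! ### The exceptional graph K_{6,2,2,1}. -/

section K6221

theorem nonempty_iso_completeMultipartiteGraph {V ι : Type*} [Fintype V] [DecidableEq ι]
    {G : SimpleGraph V} (m : ι → ℕ) (f : V → ι) (hadj : ∀ x y, G.Adj x y ↔ f x ≠ f y)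
    (hcard : ∀ i, #{x | f x = i} = m i) :
    Nonempty (G ≃g completeMultipartiteGraph fun i => Fin (m i)) := by
  have e : ∀ i, {x // f x = i} ≃ Fin (m i) := fun i =>
    Fintype.equivFinOfCardEq (by rw [Fintype.card_subtype, hcard])
  refine ⟨⟨(Equiv.sigmaFiberEquiv f).symm.trans (Equiv.sigmaCongrRight e), fun {x y} => ?_⟩⟩
  rw [hadj]
  rfl

instance : DecidableRel K6221.Adj := fun x y => inferInstanceAs (Decidable (x.1 ≠ y.1))

theorem card_edgeFinset_K6221 : #K6221.edgeFinset = 38 := by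
  have h : ∀ p, K6221.degree p = ∑ j, if p.1 = j then 0 else (![6, 2, 2, 1] : Fin 4 → ℕ) j := by
    intro p
    rw [degree_eq_sum_ite, Fintype.sum_sigma]
    refine Finset.sum_congr rfl fun j _ => ?_
    by_cases hj : p.1 = j
    · have hj' : ∀ b, ¬ K6221.Adj p ⟨j, b⟩ := fun _ h => h hj
      simp [hj, hj']
    · have hj' : ∀ b, K6221.Adj p ⟨j, b⟩ := fun _ => hj
      simp [hj, hj']
  have h2 := sum_degrees_eq_twice_card_edges K6221
  have h' : ∀ i b, K6221.degree ⟨i, b⟩ =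
      ∑ j, if i = j then 0 else (![6, 2, 2, 1] : Fin 4 → ℕ) j := fun i b => h ⟨i, b⟩
  rw [Fintype.sum_sigma, Finset.sum_congr rfl fun i _ => Finset.sum_congr rfl fun b _ => h' i b]
    at h2
  simp only [Finset.sum_const, card_univ, Fintype.card_fin, smul_eq_mul] at h2
  have h3 : ∑ i : Fin 4, (![6, 2, 2, 1] : Fin 4 → ℕ) i *
      ∑ j, (if i = j then 0 else (![6, 2, 2, 1] : Fin 4 → ℕ) j) = 76 := by decide
  rw [h3] at h2
  omega

variable {V : Type*} [DecidableEq V] {G : SimpleGraph V}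

/-- `b` parametrises T_4(6), with parts {0,4}, {1,5}, {2}, {3}. Dropping a vertex of a two-element
part leaves a K_4, which `a` must not complete to a K_5. -/
theorem CliqueFree.exists_ne_not_adj (hfree : G.CliqueFree 5) {b : Fin 6 → V}
    (hb : ∀ s t, G.Adj (b s) (b t) ↔ (s : ℕ) % 4 ≠ t % 4) (hinj : Injective b) {j : Fin 6}
    (hj : j ≠ 2 ∧ j ≠ 3) (a : V) : ∃ s ≠ j, ¬ G.Adj a (b s) := by
  by_contra! h
  obtain ⟨Q, hQ, hQj⟩ : ∃ Q : Fin 4 → Fin 6, (∀ c, (Q c : ℕ) % 4 = c) ∧ ∀ c, Q c ≠ j := by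
    by_cases h3 : j = 0 ∨ j = 1
    · refine ⟨![4, 5, 2, 3], by decide, ?_⟩
      rcases h3 with rfl | rfl <;> decide
    · have key : ∀ j : Fin 6, j ≠ 2 ∧ j ≠ 3 → ¬ (j = 0 ∨ j = 1) →
          ∀ c, (![0, 1, 2, 3] : Fin 4 → Fin 6) c ≠ j := by decide
      exact ⟨![0, 1, 2, 3], by decide, key j hj h3⟩
  have hQinj : Injective (b ∘ Q) := hinj.comp fun c d hcd => by
    have := hQ c
    rw [hcd, hQ d] at this
    exact (Fin.ext this).symm
  have hcl : G.IsNClique 4 (univ.image (b ∘ Q)) := by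
    refine ⟨?_, by rw [card_image_of_injective _ hQinj, card_univ, Fintype.card_fin]⟩
    intro x hx y hy hxy
    obtain ⟨c, -, rfl⟩ := mem_image.1 (mem_coe.1 hx)
    obtain ⟨d, -, rfl⟩ := mem_image.1 (mem_coe.1 hy)
    refine (hb _ _).2 ?_
    rw [hQ, hQ]
    intro h1
    exact hxy (by rw [Fin.ext h1])
  refine hfree _ (hcl.insert (a := a) fun x hx => ?_)
  obtain ⟨c, -, rfl⟩ := mem_image.1 hx
  exact h _ (hQj c)

variable [Fintype V]

/-- The part of size 6 is `A` together with the singleton part `b j` of T_4(6). -/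
theorem nonempty_iso_K6221_of_adj {A : Finset V} (hA : #A = 5) {b : Fin 6 → V}
    (hbA : ∀ x, x ∉ A ↔ ∃ s, b s = x) (hinj : Injective b)
    (hb : ∀ s t, G.Adj (b s) (b t) ↔ (s : ℕ) % 4 ≠ t % 4) (hind : ∀ x ∈ A, ∀ y ∈ A, ¬ G.Adj x y)
    {j : Fin 6} (hj : j = 2 ∨ j = 3) (hAb : ∀ x ∈ A, ∀ s, G.Adj x (b s) ↔ s ≠ j) :
    Nonempty (G ≃g K6221) := by
  obtain ⟨g, hg, hgj, hgc⟩ : ∃ g : Fin 6 → Fin 4, (∀ s t, g s ≠ g t ↔ (s : ℕ) % 4 ≠ t % 4) ∧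
      (∀ s, g s ≠ 0 ↔ s ≠ j) ∧
      ∀ i, (if i = 0 then 5 else 0) + #{s | g s = i} = (![6, 2, 2, 1] : Fin 4 → ℕ) i := by
    rcases hj with rfl | rfl
    · exact ⟨![1, 2, 0, 3, 1, 2], by decide, by decide, by decide⟩
    · exact ⟨![1, 2, 3, 0, 1, 2], by decide, by decide, by decide⟩
  let f : V → Fin 4 := fun x => if x ∈ A then 0 else g (invFun b x)
  have hfA : ∀ x ∈ A, f x = 0 := fun x hx => if_pos hx
  have hfb : ∀ s, f (b s) = g s := fun s => by
    have : b s ∉ A := (hbA _).2 ⟨s, rfl⟩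
    simp only [f, this, if_false, leftInverse_invFun hinj s]
  refine nonempty_iso_completeMultipartiteGraph _ f (fun x y => ?_) fun i => ?_
  · by_cases hx : x ∈ A <;> by_cases hy : y ∈ A
    · simp [hfA x hx, hfA y hy, hind x hx y hy]
    · obtain ⟨t, rfl⟩ := (hbA y).1 hy
      rw [hfA x hx, hfb, hAb x hx, ← hgj, ne_comm]
    · obtain ⟨s, rfl⟩ := (hbA x).1 hx
      rw [hfA y hy, hfb, G.adj_comm, hAb y hy, ← hgj]
    · obtain ⟨s, rfl⟩ := (hbA x).1 hx
      obtain ⟨t, rfl⟩ := (hbA y).1 hy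
      rw [hfb, hfb, hb, hg]
  · rw [← hgc i, ← filter_union_filter_not_eq (· ∈ A) (({x | f x = i} : Finset V)),
      card_union_of_disjoint (disjoint_filter_filter_not _ _ _), filter_filter, filter_filter]
    congr 1
    · split_ifs with hi
      · rw [← hA]
        congr 1
        ext x
        simp only [mem_filter, mem_univ, true_and]
        exact ⟨fun h => h.2, fun h => ⟨hi ▸ hfA x h, h⟩⟩
      · rw [card_eq_zero, filter_eq_empty_iff]
        rintro x - ⟨h1, h2⟩
        exact hi (h1.symm.trans (hfA x h2))
    · rw [← card_map ⟨b, hinj⟩]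
      congr 1
      ext x
      simp only [mem_filter, mem_univ, true_and, mem_map, Embedding.coeFn_mk]
      constructor
      · rintro ⟨h1, h2⟩
        obtain ⟨s, rfl⟩ := (hbA x).1 h2
        exact ⟨s, by rw [← hfb, h1], rfl⟩
      · rintro ⟨s, h1, rfl⟩
        exact ⟨by rw [hfb, h1], (hbA _).2 ⟨s, rfl⟩⟩

variable [DecidableRel G.Adj]

/-- Equality throughout makes `A` independent and 5-regular in `G`, with `G - A` equal to T_4(6), so
each vertex of `A` misses exactly one vertex outside. By `hlow` some `b j` outside `A` has degree
below 6. If its part had two elements, some vertex of `A` would miss it and form a K_5 with the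
rest; so its part is a singleton and it has no neighbour in `A`. -/
theorem CliqueFree.nonempty_iso_K6221 (hfree : G.CliqueFree 5) (hV : Fintype.card V = 11)
    {A : Finset V} (hA : #A = 5) (hdeg : ∀ v ∈ A, G.degree v ≤ 5) (he : 38 ≤ #G.edgeFinset)
    (hlow : 6 ≤ #{v | G.degree v < 6}) : Nonempty (G ≃g K6221) := by
  have hcard : Fintype.card {v | v ∉ A} = 6 := by
    rw [show 6 = #Aᶜ by rw [card_compl, hV, hA]]
    exact Fintype.card_of_subtype _ (by simp)
  have h1 := two_mul_card_edgeFinset_add G A (s := {v | v ∉ A}) (fun v => Iff.rfl)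
  have hfree' : (G.induce {v | v ∉ A}).CliqueFree 5 :=
    hfree.comap ⟨(Embedding.induce {v | v ∉ A}).toCopy⟩
  have h2 := hfree'.card_edgeFinset_le_turanGraph
  have h13 : #(turanGraph 6 4).edgeFinset = 13 := by decide
  rw [hcard, h13] at h2
  have h4 := Finset.sum_le_card_nsmul _ _ _ hdeg
  rw [hA, smul_eq_mul] at h4
  have hind : ∀ x ∈ A, ∀ y ∈ A, ¬ G.Adj x y := by
    have : ∑ v ∈ A, #{w ∈ A | G.Adj v w} = 0 := by omega
    intro x hx y hy hxy
    have h5 := (Finset.sum_eq_zero_iff.1 this) x hx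
    rw [card_eq_zero, filter_eq_empty_iff] at h5
    exact h5 hy hxy
  have hdeg5 : ∀ v ∈ A, G.degree v = 5 := by
    have : ∑ v ∈ A, G.degree v = ∑ v ∈ A, 5 := by
      rw [Finset.sum_const, hA, smul_eq_mul]
      omega
    exact (Finset.sum_eq_sum_iff_of_le hdeg).1 this
  obtain ⟨φ⟩ := hfree'.nonempty_iso_turanGraph (by rw [hcard, h13]; omega)
  rw [hcard] at φ
  let b : Fin 6 → V := fun s => (φ.symm s).1
  have hinj : Injective b := Subtype.val_injective.comp φ.symm.injective
  have hbA : ∀ x, x ∉ A ↔ ∃ s, b s = x := fun x =>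
    ⟨fun hx => ⟨φ ⟨x, hx⟩, by simp [b]⟩, by rintro ⟨s, rfl⟩; exact (φ.symm s).2⟩
  have hb : ∀ s t, G.Adj (b s) (b t) ↔ (s : ℕ) % 4 ≠ t % 4 := fun s t =>
    (φ.symm.map_adj_iff (v := s) (w := t))
  have hdegree : ∀ x, G.degree x = #{y ∈ A | G.Adj x y} + #{s | G.Adj x (b s)} := by
    intro x
    rw [← card_neighborFinset_eq_degree, neighborFinset_eq_filter,
      ← filter_union_filter_not_eq (· ∈ A) (({y | G.Adj x y} : Finset V)),
      card_union_of_disjoint (disjoint_filter_filter_not _ _ _), filter_filter, filter_filter,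
      ← card_map ⟨b, hinj⟩]
    congr 2
    · ext y
      simp [and_comm]
    · ext y
      simp only [mem_filter, mem_univ, true_and, mem_map, Embedding.coeFn_mk]
      constructor
      · rintro ⟨h1, h2⟩
        obtain ⟨s, rfl⟩ := (hbA y).1 h2
        exact ⟨s, h1, rfl⟩
      · rintro ⟨s, h1, rfl⟩
        exact ⟨h1, (hbA _).2 ⟨s, rfl⟩⟩
  have huniq : ∀ x ∈ A, ∀ s, ¬ G.Adj x (b s) → ∀ t, t ≠ s → G.Adj x (b t) := by
    intro x hx s hs t hts
    by_contra ht
    have h5 := hdegree x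
    rw [hdeg5 x hx] at h5
    have h6 : #{y ∈ A | G.Adj x y} = 0 := by
      rw [card_eq_zero, filter_eq_empty_iff]
      exact fun y hy => hind x hx y hy
    have h7 : #{s | G.Adj x (b s)} ≤ #((univ : Finset (Fin 6)) \ {s, t}) := by
      refine card_le_card fun r hr => ?_
      rw [mem_sdiff, mem_insert, mem_singleton]
      refine ⟨mem_univ _, ?_⟩
      have := (mem_filter.1 hr).2
      rintro (rfl | rfl)
      · exact hs this
      · exact ht this
    rw [card_sdiff_of_subset (subset_univ _), card_pair hts.symm, card_univ, Fintype.card_fin] at h7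
    omega
  obtain ⟨u, hu, huA⟩ : ∃ u, G.degree u < 6 ∧ u ∉ A := by
    by_contra! h
    have : #{v | G.degree v < 6} ≤ #A := card_le_card fun v hv => h v (mem_filter.1 hv).2
    omega
  obtain ⟨j, rfl⟩ := (hbA u).1 huA
  have hdj := hdegree (b j)
  simp only [hb] at hdj
  by_cases hj : j ≠ 2 ∧ j ≠ 3
  · exfalso
    have key : ∀ j : Fin 6, j ≠ 2 ∧ j ≠ 3 → #{s : Fin 6 | (j : ℕ) % 4 ≠ s % 4} = 4 := by decide
    have h5 := key j hj
    obtain ⟨x, hx, hxj⟩ : ∃ x ∈ A, ¬ G.Adj (b j) x := by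
      by_contra! h
      rw [filter_true_of_mem h] at hdj
      omega
    obtain ⟨s, hsj, hs⟩ := hfree.exists_ne_not_adj hb hinj hj x
    exact hs (huniq x hx j (fun h => hxj h.symm) s hsj)
  · replace hj : j = 2 ∨ j = 3 := by tauto
    have h5 : #{s : Fin 6 | (j : ℕ) % 4 ≠ s % 4} = 5 := by
      rcases hj with rfl | rfl <;> decide
    have h6 : #{y ∈ A | G.Adj (b j) y} = 0 := by omega
    rw [card_eq_zero, filter_eq_empty_iff] at h6
    have h7 : ∀ x ∈ A, ¬ G.Adj x (b j) := fun x hx h => h6 hx h.symm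
    refine nonempty_iso_K6221_of_adj hA hbA hinj hb hind hj fun x hx s => ⟨?_, ?_⟩
    · rintro h rfl
      exact h7 x hx h
    · exact huniq x hx j (h7 x hx) s

end K6221

/-! ### Assembling the bound and the equality cases. -/

section Main

variable {V : Type*} [Fintype V] [DecidableEq V] {G : SimpleGraph V} [DecidableRel G.Adj]

/-- Deleting `S` lowers each degree by at most `#S`, so both clauses of Chvátal's theorem pull back
to `G`. -/
theorem exists_of_not_isHamiltonian_induce {S : Finset V} (hS : #S + 3 ≤ Fintype.card V)
    (hG : ¬ (G.induce {v : V | v ∉ S}).IsHamiltonian) :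
    ∃ (i : ℕ) (A : Finset V), 1 ≤ i ∧ 2 * i + #S < Fintype.card V ∧ #A = i ∧
      (∀ v ∈ A, G.degree v ≤ i + #S) ∧
      Fintype.card V - #S - i ≤ #{v | G.degree v < Fintype.card V - i} := by
  have hcard : Fintype.card {v | v ∉ S} = Fintype.card V - #S := by
    rw [← card_compl]
    exact Fintype.card_of_subtype _ (by simp)
  obtain ⟨i, h1, h2, h3, h4⟩ := exists_of_not_isHamiltonian _ (by omega) hG
  obtain ⟨T, hT, hTi⟩ := exists_subset_card_eq h3
  have hle := fun v => G.degree_le_degree_induce_add_card S (s := {v | v ∉ S}) (fun _ => Iff.rfl) v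
  rw [hcard] at h2 h4
  refine ⟨i, T.map (Embedding.subtype _), h1, by omega, by rw [card_map, hTi], ?_, ?_⟩
  · intro v hv
    obtain ⟨x, hx, rfl⟩ := mem_map.1 hv
    have := (mem_filter.1 (hT hx)).2
    exact (hle x).trans (by omega)
  · rw [← card_map (Embedding.subtype _)] at h4
    refine h4.trans (card_le_card fun v hv => ?_)
    obtain ⟨x, hx, rfl⟩ := mem_map.1 hv
    have h5 := (mem_filter.1 hx).2
    have h6 := hle x
    refine mem_filter.2 ⟨mem_univ _, ?_⟩
    change G.degree x.1 < _
    omega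

theorem IsTuranPlusVertex.card_edgeFinset {n r l : ℕ} (h : G.IsTuranPlusVertex n r l) :
    #G.edgeFinset = #(turanGraph (n - 1) r).edgeFinset + (l + 1) := by
  obtain ⟨-, -, v, hv, ⟨φ⟩⟩ := h
  rw [card_edgeFinset_eq_induce_add_degree G v (s := {w | w ≠ v}) (fun _ => Iff.rfl), hv,
    φ.card_edgeFinset_eq]

theorem CliqueFree.card_edgeFinset_le_of_not_isHamiltonian_induce {r : ℕ} (hr : 3 ≤ r)
    (hfree : G.CliqueFree (r + 1)) {S : Finset V}
    (hn : (if r = 3 then 6 * #S + 26 else if r ≤ 7 then 6 * #S + 11 else 2 * #S + 9) ≤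
      Fintype.card V)
    (hG : ¬ (G.induce {v : V | v ∉ S}).IsHamiltonian) :
    #G.edgeFinset ≤ #(turanGraph (Fintype.card V - 1) r).edgeFinset + (#S + 1) ∧
    (#G.edgeFinset = #(turanGraph (Fintype.card V - 1) r).edgeFinset + (#S + 1) →
      G.IsTuranPlusVertex (Fintype.card V) r #S ∨
        (Nonempty (G ≃g K6221) ∧ #S = 0 ∧ r = 4 ∧ Fintype.card V = 11)) := by
  obtain ⟨i, A, hi, hin, hA, hdeg, hlow⟩ :=
    exists_of_not_isHamiltonian_induce (by split_ifs at hn <;> omega) hG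
  have hbound := hfree.card_edgeFinset_le_turanGraph_add hA hdeg
  rcases hi.eq_or_lt with rfl | hi
  · refine ⟨by omega, fun heq => Or.inl ⟨rfl, hfree, ?_⟩⟩
    obtain ⟨v, rfl⟩ := card_eq_one.1 hA
    have hv := hdeg v (mem_singleton_self v)
    have h1 := card_edgeFinset_eq_induce_add_degree G v (s := {w | w ≠ v}) (fun _ => Iff.rfl)
    have hfree' : (G.induce {w | w ≠ v}).CliqueFree (r + 1) :=
      hfree.comap ⟨(Embedding.induce {w | w ≠ v}).toCopy⟩
    have hcard : Fintype.card {w | w ≠ v} = Fintype.card V - 1 := by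
      exact (Fintype.card_of_subtype (univ.erase v) (by simp)).trans
        (card_erase_of_mem (mem_univ v))
    have h2 := hfree'.card_edgeFinset_le_turanGraph
    have h3 := hfree'.nonempty_iso_turanGraph
    rw [hcard] at h2 h3
    exact ⟨v, by omega, h3 (by omega)⟩
  · by_cases hr3 : r = 3
    · subst hr3
      rw [if_pos rfl] at hn
      have := hfree.card_edgeFinset_lt_of_three hA hi hdeg hin hn
      exact ⟨this.le, fun heq => absurd heq this.ne⟩
    · rw [if_neg hr3] at hn
      obtain ⟨h1, h2⟩ := turan_add_le (by omega) hi hin hn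
      refine ⟨hbound.trans h1, fun heq => Or.inr ?_⟩
      obtain ⟨hS, rfl, hV, rfl⟩ := h2 (le_antisymm h1 (heq ▸ hbound))
      refine ⟨?_, hS, rfl, hV⟩
      rw [hS, hV] at heq hlow
      have h37 : #(turanGraph (11 - 1) 4).edgeFinset = 37 := by decide
      exact hfree.nonempty_iso_K6221 hV hA (by simpa [hS] using hdeg) (by omega) hlow

end Main

end SimpleGraph

open SimpleGraph in
theorem mainTheorem5 {V : Type*} [Fintype V] [DecidableEq V] (G : SimpleGraph V)
    [DecidableRel G.Adj] (n r k : ℕ) (hV : Fintype.card V = n) (hr : 3 ≤ r)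
    (hn : (if r = 3 then 6 * k + 26 else if r ≤ 7 then 6 * k + 11 else 2 * k + 9) ≤ n)
    (hfree : G.CliqueFree (r + 1)) (hG : ¬ G.IsKHamiltonian k) :
    G.edgeFinset.card ≤ (SimpleGraph.turanGraph (n - 1) r).edgeFinset.card + (k + 1) ∧
    (G.edgeFinset.card = (SimpleGraph.turanGraph (n - 1) r).edgeFinset.card + (k + 1) ↔
      G.IsTuranPlusVertex n r k ∨
        (Nonempty (G ≃g SimpleGraph.K6221) ∧ k = 0 ∧ r = 4 ∧ n = 11)) := by
  subst hV
  obtain ⟨S, hSk, hS⟩ : ∃ S : Finset V, S.card ≤ k ∧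
      ¬ (G.induce {v : V | v ∉ S}).IsHamiltonian := by
    simpa [IsKHamiltonian] using hG
  obtain ⟨h1, h2⟩ := hfree.card_edgeFinset_le_of_not_isHamiltonian_induce hr
    (by split_ifs at hn ⊢ <;> omega) hS
  refine ⟨by omega, fun heq => ?_, ?_⟩
  · obtain rfl : S.card = k := by omega
    exact h2 heq
  · rintro (h | ⟨⟨φ⟩, rfl, rfl, hV⟩)
    · exact h.card_edgeFinset
    · rw [φ.card_edgeFinset_eq, card_edgeFinset_K6221, hV]
      decide
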